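/- Let $n\ge 0$ and $N=\{1,\dots,n\}$. A simple game $v$ on $N$ is a family $W_v$ of subsets of $N$ (the winning coalitions) with $N\in W_v$, $\emptyset\notin W_v$, and $R\in W_v$ whenever $S\in W_v$ and $S\subseteq R\subseteq N$. Voter $i$ is at least as desirable as voter $j$, written $i\succeq j$, if $S\cup\{j\}\in W_v$ implies $S\cup\{i\}\in W_v$ for all $S\subseteq N\setminus\{i,j\}$. The game is linear if any two voters are comparable under $\succeq$; it is weighted if there are weights $w_i\ge 0$ and a quota $q\in(0,\sum_i w_i]$ such that $A\in W_v$ if and only if $\sum_{i\in A}w_i\ge q$; it is proper if there is no $A\subseteq N$ with both $A$ and $N\setminus A$ in $W_v$. The rank of $v$ is its number of losing coalitions, $2^n-|W_v|$. Let $J_n$ be the set of linear games on $N$ whose voters are enumerated by increasing desirability ($j\succeq i$ whenever $i\le j$), partially ordered by: $v$ is above $u$ if $W_v\subseteq W_u$. Let $J_n^+$ (games of rank at least $2^{n-1}$) and $\Pi_n$ (proper games) be induced subposets of $J_n$. Let $\mathcal W_n$ be the set of weighted games in $J_n$, with the partial order generated by the relations "$W_u=W_v\cup\{A\}$ for some $A\notin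 W_v$" ($v$ above $u$, both weighted), and let $\mathcal W_n^+$ be its induced subposet of proper games. Theorem. For every $n$ the following inclusions of posets (as not necessarily induced subposets) hold: $$\mathcal W_n^+\subset\Pi_n\subset J_n^+ .$$ Moreover, $\mathcal W_n^+$ is also the induced subposet of $\mathcal W_n$ formed by the weighted games of rank at least $2^{n-1}$. The first inclusion is strict (as an inclusion of sets of games) if and only if $n\ge 7$, and the second is strict if and only if $n\ge 6$. For $n\le 6$ one has $\mathcal W_n^+=\Pi_n$, and for $n\le 5$ one has $\Pi_n=J_n^+$, as posets. -/

import Mathlib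

/-- A simple game with voters `Fin n` (the element `i : Fin n` plays the role of voter `i + 1`):
a family of winning coalitions that contains the grand coalition, does not contain the empty
coalition, and is closed under enlarging coalitions. -/
@[ext]
structure SimpleGame (n : ℕ) where
  /-- The winning coalitions. -/
  winning : Finset (Finset (Fin n))
  univ_mem : Finset.univ ∈ winning
  empty_notMem : ∅ ∉ winning
  mono : ∀ S R : Finset (Fin n), S ∈ winning → S ⊆ R → R ∈ winning

namespace SimpleGame

/-- Voter `i` is at least as desirable as voter `j`: in every coalition that contains `j` but not
`i`, replacing `j` by `i` preserves winning. -/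
def MoreDesirable {n : ℕ} (v : SimpleGame n) (i j : Fin n) : Prop :=
  ∀ S : Finset (Fin n), i ∉ S → j ∉ S → insert j S ∈ v.winning → insert i S ∈ v.winning

/-- A simple game is linear if any two voters are comparable under desirability. -/
def IsLinear {n : ℕ} (v : SimpleGame n) : Prop :=
  ∀ i j : Fin n, v.MoreDesirable i j ∨ v.MoreDesirable j i

/-- The voters are enumerated by (weakly) increasing desirability. -/
def IsOrdered {n : ℕ} (v : SimpleGame n) : Prop :=
  ∀ i j : Fin n, i ≤ j → v.MoreDesirable j i

/-- A simple game is weighted if it is realized by nonnegative weights and a quota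
in `(0, ∑ w i]`. -/
def IsWeighted {n : ℕ} (v : SimpleGame n) : Prop :=
  ∃ (w : Fin n → ℝ) (q : ℝ), (∀ i, 0 ≤ w i) ∧ 0 < q ∧ q ≤ ∑ i, w i ∧
    ∀ A : Finset (Fin n), A ∈ v.winning ↔ q ≤ ∑ i ∈ A, w i

/-- A simple game is proper if no two complementary coalitions both win. -/
def IsProper {n : ℕ} (v : SimpleGame n) : Prop :=
  ∀ A : Finset (Fin n), ¬ (A ∈ v.winning ∧ Aᶜ ∈ v.winning)

/-- The rank of a game: the number of losing coalitions. -/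
def rank {n : ℕ} (v : SimpleGame n) : ℕ :=
  (v.winningᶜ).card

/-- The rank is at least half of the maximal rank `2 ^ n`. -/
def InTopHalf {n : ℕ} (v : SimpleGame n) : Prop :=
  2 ^ n ≤ 2 * v.rank

/-- `v.CoversGame u`: the winning coalitions of `u` are those of `v` and exactly one more. -/
def CoversGame {n : ℕ} (v u : SimpleGame n) : Prop :=
  ∃ A : Finset (Fin n), A ∉ v.winning ∧ u.winning = insert A v.winning

end SimpleGame

/-- A partially ordered set of simple games on `n` voters: a set of games and a partial order on
that set (the relation `le` only relates members of the set). -/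
@[ext]
structure GamePoset (n : ℕ) where
  /-- The set of elements. -/
  carrier : Set (SimpleGame n)
  /-- The order relation. -/
  le : SimpleGame n → SimpleGame n → Prop
  mem_of_le : ∀ u v, le u v → u ∈ carrier ∧ v ∈ carrier
  le_refl : ∀ v ∈ carrier, le v v
  le_trans : ∀ u v w, le u v → le v w → le u w
  le_antisymm : ∀ u v, le u v → le v u → u = v

namespace GamePoset

/-- `P` is a (not necessarily induced) subposet of `Q`. -/
def IsSubposet {n : ℕ} (P Q : GamePoset n) : Prop :=
  P.carrier ⊆ Q.carrier ∧ ∀ u v, P.le u v → Q.le u v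

/-- The induced subposet of `P` formed by its elements with property `p`. -/
def induced {n : ℕ} (P : GamePoset n) (p : SimpleGame n → Prop) : GamePoset n where
  carrier := {v | v ∈ P.carrier ∧ p v}
  le u v := P.le u v ∧ p u ∧ p v
  mem_of_le u v h := ⟨⟨(P.mem_of_le u v h.1).1, h.2.1⟩, ⟨(P.mem_of_le u v h.1).2, h.2.2⟩⟩
  le_refl v hv := ⟨P.le_refl v hv.1, hv.2, hv.2⟩
  le_trans u v w h₁ h₂ := ⟨P.le_trans u v w h₁.1 h₂.1, h₁.2.1, h₂.2.2⟩
  le_antisymm u v h₁ h₂ := P.le_antisymm u v h₁.1 h₂.1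

end GamePoset

/-- The poset `J_n` of linear games on `n` voters, the voters being enumerated by increasing
desirability. A game `v` is above `u` if every winning coalition of `v` also wins in `u`. -/
def linearPoset (n : ℕ) : GamePoset n where
  carrier := {v | v.IsLinear ∧ v.IsOrdered}
  le u v := (u.IsLinear ∧ u.IsOrdered) ∧ (v.IsLinear ∧ v.IsOrdered) ∧ v.winning ⊆ u.winning
  mem_of_le _ _ h := ⟨h.1, h.2.1⟩
  le_refl _ hv := ⟨hv, hv, Finset.Subset.refl _⟩
  le_trans _ _ _ h₁ h₂ := ⟨h₁.1, h₂.2.1, h₂.2.2.trans h₁.2.2⟩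
  le_antisymm _ _ h₁ h₂ := SimpleGame.ext (Finset.Subset.antisymm h₂.2.2 h₁.2.2)

/-- One step up among weighted games of `J_n`: `v` covers `u`, both being weighted. -/
def WeightedStep {n : ℕ} (u v : SimpleGame n) : Prop :=
  (u ∈ (linearPoset n).carrier ∧ u.IsWeighted) ∧ (v ∈ (linearPoset n).carrier ∧ v.IsWeighted) ∧
    v.CoversGame u

theorem winning_subset_of_chain {n : ℕ} {u v : SimpleGame n}
    (h : Relation.ReflTransGen WeightedStep u v) : v.winning ⊆ u.winning := by
  induction h with
  | refl => exact Finset.Subset.refl _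
  | tail _ hs ih =>
    obtain ⟨_, _, A, _, hA⟩ := hs
    refine Finset.Subset.trans ?_ ih
    rw [hA]
    exact Finset.subset_insert _ _

/-- The poset `W_n` of weighted games on `n` voters, the voters being enumerated by increasing
desirability. Its order is generated by the covering relation between weighted games. -/
def weightedPoset (n : ℕ) : GamePoset n where
  carrier := {v | v ∈ (linearPoset n).carrier ∧ v.IsWeighted}
  le u v := (u ∈ (linearPoset n).carrier ∧ u.IsWeighted) ∧
    (v ∈ (linearPoset n).carrier ∧ v.IsWeighted) ∧ Relation.ReflTransGen WeightedStep u v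
  mem_of_le _ _ h := ⟨h.1, h.2.1⟩
  le_refl _ hv := ⟨hv, hv, Relation.ReflTransGen.refl⟩
  le_trans _ _ _ h₁ h₂ := ⟨h₁.1, h₂.2.1, h₁.2.2.trans h₂.2.2⟩
  le_antisymm _ _ h₁ h₂ := SimpleGame.ext (Finset.Subset.antisymm
    (winning_subset_of_chain h₂.2.2) (winning_subset_of_chain h₁.2.2))

/-- `J_n^+`: the top half of `J_n`. -/
def topLinearPoset (n : ℕ) : GamePoset n :=
  (linearPoset n).induced SimpleGame.InTopHalf

/-- `Π_n`: the proper linear games, as an induced subposet of `J_n`. -/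
def properLinearPoset (n : ℕ) : GamePoset n :=
  (linearPoset n).induced SimpleGame.IsProper

/-- `W_n^+`: the proper weighted games, as an induced subposet of `W_n`. -/
def properWeightedPoset (n : ℕ) : GamePoset n :=
  (weightedPoset n).induced SimpleGame.IsProper

/-- The weighted games in the top half, as an induced subposet of `W_n`. -/
def topWeightedPoset (n : ℕ) : GamePoset n :=
  (weightedPoset n).induced SimpleGame.InTopHalf

namespace SimpleGame

/-- The coalition of six voters encoded by the binary digits of `c`. -/
def coalition (c : ℕ) : Finset (Fin 6) :=
  Finset.univ.filter fun i => c.testBit i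

/-- Whether coalition `c` may be added to the family `m`, encoded by its binary digits: the
coalitions that cover `c` in the shift order belong to `m`, and the complement of `c` does not. -/
def admissible (c m : ℕ) : Bool :=
  (c.testBit 0 || m.testBit (c + 1)) &&
  (!c.testBit 0 || c.testBit 1 || m.testBit (c + 1)) &&
  (!c.testBit 1 || c.testBit 2 || m.testBit (c + 2)) &&
  (!c.testBit 2 || c.testBit 3 || m.testBit (c + 4)) &&
  (!c.testBit 3 || c.testBit 4 || m.testBit (c + 8)) &&
  (!c.testBit 4 || c.testBit 5 || m.testBit (c + 16)) &&
  !m.testBit (63 - c)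

/-- The extensions of the family `m` by coalitions below `c`, added in decreasing order and each
admissible when it is added. -/
def extensions : ℕ → ℕ → List ℕ
  | 0, m => [m]
  | c + 1, m => (if admissible c m then extensions c (m ||| 2 ^ c) else []) ++ extensions c m

/-- The total weight of those of the first `k` voters that belong to coalition `c`, the weights of
the voters `k - 1, …, 0` being the decimal digits of `t`, starting with the last one. -/
def digitWeight : ℕ → ℕ → ℕ → ℕ
  | 0, _, _ => 0
  | k + 1, t, c => c / 2 ^ k % 2 * (t % 10) + digitWeight k (t / 10) c

/-- Whether the coalitions in `m`, among those whose code becomes `e` when the last `k` binary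
digits are removed, are the ones of weight at least `q` in the sense of `digitWeight k t`. -/
def agrees (m : ℕ) : ℕ → ℕ → ℕ → ℕ → Bool
  | 0, _, q, e => m.testBit e == (q == 0)
  | k + 1, t, q, e => agrees m k (t / 10) q (2 * e) && agrees m k (t / 10) (q - t % 10) (2 * e + 1)

/-- Whether each family in the first list is realized by the entry of the second list at the same
position: the last six decimal digits are the weights and the preceding digits are the quota. -/
def realizesAll : List ℕ → List ℕ → Bool
  | [], _ => true
  | _ :: _, [] => false
  | m :: ms, t :: ts => agrees m 6 t (t / 1000000) 0 && realizesAll ms ts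

/-- A quota followed by six one-digit weights for each proper linear game with six voters. -/
def quotaWeights : List ℕ :=
  [1000001, 5111114, 6111115, 4011113, 9122227, 5011114, 7112225, 11123338, 8112226, 9112227,
   3001112, 10113337, 7012225, 11113338, 4001113, 6111224, 13223449, 10122337, 7111225, 8111226,
   8112335, 11113447, 14223559, 9112336, 13123449, 10112337, 11112338, 5011223, 13123558, 8012335,
   11122447, 14123559, 6011224, 13122449, 7011225, 7111334, 12122557, 10112446, 13113558, 8111335,
   11112447, 14122559, 9111336, 10111337, 2000111, 9111445, 7011334, 12112557, 5001223, 10111446,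
   13112558, 8011335, 11111447, 3000112, 5111123, 11222347, 12223348, 9122236, 6111124, 7111125,
   7112234, 15224569, 10113346, 12223357, 13223458, 8112235, 12123348, 9112236, 10112237, 9122345,
   14133568, 16234579, 12123457, 15124569, 14233468, 10122346, 13123458, 11122347, 12122348,
   13122349, 6111233, 13222567, 15233578, 11122456, 13223467, 9112345, 12113457, 11222356, 7111234,
   10112346, 13122458, 8111235, 9111236, 8111344, 13122567, 11112456, 14113568, 9111345, 12112457,
   15122569, 10111346, 11111347, 4011122, 13133467, 9022345, 11123356, 16134579, 7012234, 9122245,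
   14133468, 12123357, 5011123, 11122247, 6011124, 10122355, 15133578, 17234589, 13123467,
   16124579, 15233478, 11122356, 14123468, 12122357, 13122358, 14122359, 6011233, 15123578,
   9012345, 13122467, 16123579, 7011234, 15122469, 8011235, 8112244, 17224589, 11113356, 13223367,
   15223478, 9112245, 14123368, 10112246, 11112247, 10112355, 13113467, 17223589, 11112356,
   16123479, 12112357, 13112358, 4001122, 13113367, 9012245, 14113368, 5001123, 6111133, 13222367,
   15223378, 11122256, 7111134, 8111135, 8111244, 17223489, 13122367, 9111245, 10111246, 10112255,
   15123378, 11112256, 12112257, 6011133, 13122267, 7011134, 8111144, 9111145, 2000011, 4111112,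
   9222235, 10222336, 11223337, 8122225, 5111113, 6111114, 6112223, 13224457, 14224558, 9113335,
   10223335, 11223346, 12223447, 7112224, 11123337, 8112225, 9112226, 8122334, 17244679, 13133557,
   14234557, 15234568, 11123446, 14124558, 12233446, 13233457, 9122335, 12123447, 10122336,
   11122337, 12122338, 5111222, 11222455, 12222556, 13233556, 14233567, 10122445, 11223445,
   12223456, 8112334, 11113446, 9222334, 10222345, 6111223, 9112335, 12122447, 7111224, 8111225,
   7111333, 12122556, 10112445, 13113557, 8111334, 11112446, 14122558, 9111335, 10111336, 7122233,
   11133355, 15244567, 12133456, 17144679, 13234456, 10123345, 15134568, 13124457, 11233345,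
   8122234, 13133457, 11123346, 9122235, 10122236, 11122237, 12233455, 9122344, 14133567, 18345678,
   15234567, 12123456, 15124568, 16344567, 13233456, 10122345, 13123457, 11122346, 12122347,
   13122348, 11122455, 14123567, 17124679, 12122456, 15123568, 13122457, 14122458, 15122459,
   10223344, 7112233, 15224567, 10113345, 14334456, 11223345, 13223456, 8112234, 13123357, 9112235,
   10112236, 9112344, 12113456, 15223567, 10112345, 15123468, 11112346, 12112347, 11113355,
   12113356, 17124479, 13113357, 14113358, 8222233, 5111122, 11222345, 13223356, 10122245, 6111123,
   7111124, 7111233, 15223467, 12122356, 8111234, 9111235, 9112244, 14123367, 10112245, 11112246,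
   11122255, 12122256, 13122257, 7111133, 8111134, 9111144, 3011111, 10133344, 7022233, 11133445,
   15144567, 8022334, 9123334, 13134456, 14134557, 6012223, 7122223, 11133345, 12133446, 10123335,
   4011112, 9122225, 5011113, 8122333, 12133455, 13133556, 14234556, 18245678, 11123445, 14124557,
   12233445, 16244567, 9122334, 12123446, 10122335, 11122336, 12122337, 5011222, 13123556, 8012334,
   11122445, 14123557, 6011223, 13122447, 7011224, 13234455, 10123344, 18235678, 13124456,
   17345567, 14234456, 16234567, 11123345, 12123346, 13123347, 14123348, 12123455, 15124567,
   18234678, 13123456, 14123457, 15123458, 16123459, 7012233, 15124467, 8012234, 17124469, 9012235,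
   11233344, 8122233, 14233456, 16234467, 9122234, 10122235, 11122236, 10122344, 18234578,
   11122345, 12122346, 13122347, 12123355, 13123356, 14123357, 15123358, 5011122, 11122245,
   6011123, 12122255, 13122256, 7011133, 6112222, 13224455, 14224556, 9113334, 10223334, 17335567,
   12223445, 7112223, 11123335, 8112224, 9112225, 8112333, 11113445, 14223556, 9112334, 13123446,
   10112335, 11112336, 10113344, 11113345, 15124457, 12113346, 13113347, 14334455, 11223344,
   17334567, 12223345, 16234457, 13223346, 15223348, 13223455, 14223456, 18234568, 15223457,
   17223459, 8112233, 12123345, 9112234, 10112235, 13123355, 14123356, 15123357, 10112244,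
   11112245, 12112255, 3001111, 10113334, 7012223, 11113335, 4001112, 11113344, 15124456, 12113345,
   13113346, 8012233, 17124467, 9012234, 13113355, 14113356, 5001122, 9222333, 14333455, 10222334,
   17334557, 14233446, 11222335, 13222337, 6111222, 13223445, 10122334, 7111223, 8111224, 14223455,
   18234567, 15223456, 17223458, 11122344, 12122345, 13122346, 8111233, 9111234, 10111244, 9112333,
   13123445, 10112334, 11112335, 14123455, 15123456, 16123457, 11112344, 12112345, 13112355,
   6011222, 13122445, 7011223, 14122455, 15122456, 8011233, 9111333, 10111334, 11111344, 3000111,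
   4111111, 9222233, 14333445, 11223334, 8122223, 5111112, 6111113, 10222333, 17334556, 14233445,
   11222334, 13222336, 12223344, 16234456, 13223345, 15223347, 9122233, 10122234, 11122235,
   6111122, 7111123, 8111133, 7112222, 11123334, 8112223, 9112224, 12123344, 13123345, 14123346,
   9112233, 10112234, 11112244, 10122333, 11122334, 12122335, 12122344, 13122345, 14122355,
   7111222, 8111223, 9111233, 10111333, 4011111, 9122223, 5011112, 10122233, 11122234, 6011122,
   11122333, 12122334, 13122344, 7011222, 8112222, 9112223, 10112233, 11112333, 4001111, 5111111,
   6111112, 7111122, 8111222, 9112222, 5011111, 6111111]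

theorem realizesAll_quotaWeights :
    realizesAll (extensions 63 (2 ^ 63)) quotaWeights = true := by
  decide +kernel

theorem exists_of_realizesAll {ms ts : List ℕ} (h : realizesAll ms ts = true) {m : ℕ}
    (hm : m ∈ ms) : ∃ t, agrees m 6 t (t / 1000000) 0 = true := by
  induction ms generalizing ts with
  | nil => simp at hm
  | cons a ms ih =>
    cases ts with
    | nil => simp [realizesAll] at h
    | cons t ts =>
      simp only [realizesAll, Bool.and_eq_true] at h
      rcases List.mem_cons.1 hm with rfl | hm
      · exact ⟨t, h.1⟩
      · exact ih h.2 hm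

theorem testBit_iff_of_agrees {m k t q c : ℕ} (h : agrees m k t q (c / 2 ^ k) = true) :
    m.testBit c = true ↔ q ≤ digitWeight k t c := by
  induction k generalizing t q with
  | zero =>
    simp only [agrees, pow_zero, Nat.div_one, beq_iff_eq] at h
    simp [h, digitWeight]
  | succ k ih =>
    simp only [agrees, Bool.and_eq_true] at h
    have hc : c / 2 ^ (k + 1) = c / 2 ^ k / 2 := by rw [pow_succ, Nat.div_div_eq_div_mul]
    rw [hc] at h
    rcases Nat.mod_two_eq_zero_or_one (c / 2 ^ k) with h0 | h1
    · have he : 2 * (c / 2 ^ k / 2) = c / 2 ^ k := by omega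
      rw [he] at h
      rw [ih h.1, digitWeight, h0, zero_mul, zero_add]
    · have he : 2 * (c / 2 ^ k / 2) + 1 = c / 2 ^ k := by omega
      rw [he] at h
      rw [ih h.2, digitWeight, h1, one_mul, Nat.sub_le_iff_le_add']

theorem exists_mem_extensions {p : ℕ → Prop}
    (hp : ∀ c m, p c → (∀ d, m.testBit d = true ↔ c + 1 ≤ d ∧ p d) → admissible c m = true)
    (c m : ℕ) (hm : ∀ d, m.testBit d = true ↔ c ≤ d ∧ p d) :
    ∃ m' ∈ extensions c m, ∀ d, m'.testBit d = true ↔ p d := by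
  induction c generalizing m with
  | zero => exact ⟨m, by simp [extensions], by simpa using hm⟩
  | succ c ih =>
    by_cases hc : p c
    · obtain ⟨m', hm', h⟩ := ih (m ||| 2 ^ c) fun d => by
        rw [Nat.testBit_or, Nat.testBit_two_pow, Bool.or_eq_true, hm, decide_eq_true_eq]
        constructor
        · rintro (h | rfl)
          exacts [⟨by omega, h.2⟩, ⟨le_rfl, hc⟩]
        · rintro ⟨h, h'⟩
          rcases h.eq_or_lt with h | h
          exacts [Or.inr h, Or.inl ⟨h, h'⟩]
      exact ⟨m', by simp [extensions, hp c m hc hm, hm'], h⟩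
    · obtain ⟨m', hm', h⟩ := ih m fun d => by
        rw [hm]
        refine and_congr_left fun hd => ⟨fun h => by omega, fun h => ?_⟩
        rcases h.eq_or_lt with rfl | h
        exacts [absurd hd hc, h]
      exact ⟨m', by simp [extensions, hm'], h⟩

theorem coalition_surjective (A : Finset (Fin 6)) : ∃ c < 64, coalition c = A := by
  revert A
  decide +kernel

theorem coalition_compl : ∀ c < 64, (coalition c)ᶜ = coalition (63 - c) := by
  decide +kernel

theorem coalition_subset_succ : ∀ c < 64, c.testBit 0 = false →
    c + 1 < 64 ∧ coalition c ⊆ coalition (c + 1) := by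
  decide +kernel

theorem coalition_shift : ∀ c < 64, ∀ i : Fin 5, c.testBit i = true → c.testBit (i + 1) = false →
    c + 2 ^ (i : ℕ) < 64 ∧ coalition c = insert i.castSucc ((coalition c).erase i.castSucc) ∧
      i.succ ∉ (coalition c).erase i.castSucc ∧
      coalition (c + 2 ^ (i : ℕ)) = insert i.succ ((coalition c).erase i.castSucc) := by
  decide +kernel

theorem sum_coalition (t c : ℕ) :
    ∑ i ∈ coalition c, t / 10 ^ (5 - (i : ℕ)) % 10 = digitWeight 6 t c := by
  have hbit (k x : ℕ) : (if c.testBit k = true then x else 0) = c / 2 ^ k % 2 * x := by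
    rw [Nat.testBit_eq_decide_div_mod_eq]
    rcases Nat.mod_two_eq_zero_or_one (c / 2 ^ k) with h | h <;> simp [h]
  simp only [coalition, Finset.sum_filter, hbit, Fin.sum_univ_six, digitWeight,
    Nat.div_div_eq_div_mul]
  norm_num
  ring

end SimpleGame

namespace SimpleGame

variable {n : ℕ}

theorem isLinear_of_isOrdered {v : SimpleGame n} (h : v.IsOrdered) : v.IsLinear := fun i j =>
  (le_total i j).symm.imp (h j i) (h i j)

theorem mem_linearPoset {v : SimpleGame n} : v ∈ (linearPoset n).carrier ↔ v.IsOrdered :=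
  ⟨fun h => h.2, fun h => ⟨isLinear_of_isOrdered h, h⟩⟩

theorem isWeighted_of_mem_iff {v : SimpleGame n} (w : Fin n → ℝ) (q : ℝ) (hw : ∀ i, 0 ≤ w i)
    (h : ∀ A : Finset (Fin n), A ∈ v.winning ↔ q ≤ ∑ i ∈ A, w i) : v.IsWeighted := by
  refine ⟨w, q, hw, ?_, (h _).1 v.univ_mem, h⟩
  have := mt (h ∅).2 v.empty_notMem
  rwa [Finset.sum_empty, not_le] at this

theorem inTopHalf_iff {v : SimpleGame n} : v.InTopHalf ↔ 2 * v.winning.card ≤ 2 ^ n := by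
  have h : v.winning.card + v.rank = 2 ^ n := by
    rw [rank, Finset.card_add_card_compl, Fintype.card_finset, Fintype.card_fin]
  unfold InTopHalf
  omega

theorem card_image_compl (v : SimpleGame n) :
    (v.winning.image compl).card = v.winning.card :=
  Finset.card_image_of_injective _ compl_injective

theorem IsProper.inTopHalf {v : SimpleGame n} (h : v.IsProper) : v.InTopHalf := by
  have hd : Disjoint v.winning (v.winning.image compl) := by
    rw [Finset.disjoint_left]
    intro A hA hA'
    obtain ⟨B, hB, rfl⟩ := Finset.mem_image.1 hA'
    exact h B ⟨hB, hA⟩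
  have hc := Finset.card_le_univ (v.winning ∪ v.winning.image compl)
  rw [Finset.card_union_of_disjoint hd, card_image_compl, Fintype.card_finset,
    Fintype.card_fin] at hc
  rw [inTopHalf_iff]
  omega

theorem IsWeighted.isProper_of_inTopHalf {v : SimpleGame n} (h : v.IsWeighted)
    (ht : v.InTopHalf) : v.IsProper := by
  rintro A ⟨hA, hA'⟩
  obtain ⟨w, q, -, -, -, hw⟩ := h
  have hsum (B : Finset (Fin n)) : ∑ i ∈ B, w i + ∑ i ∈ Bᶜ, w i = ∑ i, w i :=
    Finset.sum_add_sum_compl B w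
  have hu : v.winning ∪ v.winning.image compl = Finset.univ := by
    refine Finset.eq_univ_of_forall fun B => ?_
    rw [Finset.mem_union]
    by_contra! hB
    have h₁ := mt (hw B).2 hB.1
    have h₂ := mt (hw Bᶜ).2 fun h => hB.2 (Finset.mem_image.2 ⟨Bᶜ, h, compl_compl B⟩)
    linarith [hsum A, hsum B, (hw A).1 hA, (hw Aᶜ).1 hA']
  have hi : 0 < (v.winning ∩ v.winning.image compl).card :=
    Finset.card_pos.2 ⟨A, Finset.mem_inter.2 ⟨hA, Finset.mem_image.2 ⟨Aᶜ, hA', compl_compl A⟩⟩⟩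
  have hc := Finset.card_union_add_card_inter v.winning (v.winning.image compl)
  rw [hu, Finset.card_univ, card_image_compl, Fintype.card_finset, Fintype.card_fin] at hc
  rw [inTopHalf_iff] at ht
  omega

theorem isProper_iff_inTopHalf {v : SimpleGame n} (h : v.IsWeighted) :
    v.IsProper ↔ v.InTopHalf :=
  ⟨IsProper.inTopHalf, h.isProper_of_inTopHalf⟩

/-- The game with an additional voter that is a null voter, placed first. -/
def addNull (v : SimpleGame n) : SimpleGame (n + 1) where
  winning := Finset.univ.filter fun A => (Finset.univ.filter fun i => Fin.succ i ∈ A) ∈ v.winning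
  univ_mem := by simpa using v.univ_mem
  empty_notMem := by simpa using v.empty_notMem
  mono S R hS h := by
    simp only [Finset.mem_filter_univ] at hS ⊢
    exact v.mono _ _ hS fun i hi => by simp only [Finset.mem_filter_univ] at hi ⊢; exact h hi

theorem mem_addNull {v : SimpleGame n} {A : Finset (Fin (n + 1))} :
    A ∈ v.addNull.winning ↔ (Finset.univ.filter fun i => Fin.succ i ∈ A) ∈ v.winning := by
  simp [addNull]

theorem map_succ_mem_addNull {v : SimpleGame n} {A : Finset (Fin n)} :
    A.map (Fin.succEmb n) ∈ v.addNull.winning ↔ A ∈ v.winning := by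
  simp [mem_addNull]

theorem IsOrdered.addNull {v : SimpleGame n} (h : v.IsOrdered) : v.addNull.IsOrdered := by
  intro i j hij S hj hi hS
  rw [mem_addNull] at hS ⊢
  cases i using Fin.cases with
  | zero =>
    refine v.mono _ _ hS fun k hk => ?_
    simp only [Finset.mem_filter_univ, Finset.mem_insert] at hk ⊢
    exact Or.inr (hk.resolve_left (Fin.succ_ne_zero k))
  | succ i =>
    cases j using Fin.cases with
    | zero => exact absurd hij (by simp)
    | succ j =>
      have hins (k : Fin n) : (Finset.univ.filter fun l => Fin.succ l ∈ insert k.succ S) =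
          insert k (Finset.univ.filter fun l => Fin.succ l ∈ S) := by
        ext l; simp
      rw [hins] at hS ⊢
      exact h i j (Fin.succ_le_succ_iff.1 hij) _ (by simpa using hj) (by simpa using hi) hS

theorem isProper_addNull {v : SimpleGame n} : v.addNull.IsProper ↔ v.IsProper := by
  have hc (A : Finset (Fin (n + 1))) : (Finset.univ.filter fun i => Fin.succ i ∈ Aᶜ) =
      (Finset.univ.filter fun i => Fin.succ i ∈ A)ᶜ := by
    ext; simp
  constructor
  · intro h A hA
    refine h (A.map (Fin.succEmb n)) ⟨map_succ_mem_addNull.2 hA.1, ?_⟩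
    rw [mem_addNull, hc]
    simpa using hA.2
  · intro h A hA
    rw [mem_addNull, mem_addNull, hc] at hA
    exact h _ hA

theorem isWeighted_of_addNull {v : SimpleGame n} (h : v.addNull.IsWeighted) : v.IsWeighted := by
  obtain ⟨w, q, hw, -, -, h⟩ := h
  refine isWeighted_of_mem_iff (fun i => w i.succ) q (fun i => hw _) fun A => ?_
  rw [← map_succ_mem_addNull, h, Finset.sum_map]
  rfl

theorem InTopHalf.addNull {v : SimpleGame n} (h : v.InTopHalf) : v.addNull.InTopHalf := by
  rw [inTopHalf_iff] at h ⊢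
  have hsub : v.addNull.winning ⊆ v.winning.image (fun A => A.map (Fin.succEmb n)) ∪
      v.winning.image (fun A => insert 0 (A.map (Fin.succEmb n))) := by
    intro A hA
    rw [mem_addNull] at hA
    rw [Finset.mem_union, Finset.mem_image, Finset.mem_image]
    by_cases h0 : 0 ∈ A
    · refine Or.inr ⟨_, hA, ?_⟩
      ext i
      cases i using Fin.cases <;> simp [h0]
    · refine Or.inl ⟨_, hA, ?_⟩
      ext i
      cases i using Fin.cases <;> simp [h0]
  have h₁ := (Finset.card_le_card hsub).trans (Finset.card_union_le _ _)
  have h₂ := Finset.card_image_le (s := v.winning) (f := fun A => A.map (Fin.succEmb n))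
  have h₃ := Finset.card_image_le (s := v.winning) (f := fun A => insert 0 (A.map (Fin.succEmb n)))
  rw [pow_succ]
  omega

/-- The game with an additional voter that has a veto, placed last. -/
def addVeto (v : SimpleGame n) : SimpleGame (n + 1) where
  winning := Finset.univ.filter fun A =>
    Fin.last n ∈ A ∧ (Finset.univ.filter fun i => Fin.castSucc i ∈ A) ∈ v.winning
  univ_mem := by simpa using v.univ_mem
  empty_notMem := by simp
  mono S R hS h := by
    simp only [Finset.mem_filter_univ] at hS ⊢
    exact ⟨h hS.1, v.mono _ _ hS.2 fun i hi => by
      simp only [Finset.mem_filter_univ] at hi ⊢; exact h hi⟩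

theorem mem_addVeto {v : SimpleGame n} {A : Finset (Fin (n + 1))} :
    A ∈ v.addVeto.winning ↔
      Fin.last n ∈ A ∧ (Finset.univ.filter fun i => Fin.castSucc i ∈ A) ∈ v.winning := by
  simp [addVeto]

theorem IsOrdered.addVeto {v : SimpleGame n} (h : v.IsOrdered) : v.addVeto.IsOrdered := by
  intro i j hij S hj hi hS
  rcases hij.eq_or_lt with rfl | hij
  · exact hS
  rw [mem_addVeto] at hS ⊢
  cases i using Fin.lastCases with
  | last => exact absurd hij (not_lt.2 (Fin.le_last j))
  | cast i =>
    have hS₁ : Fin.last n ∈ S := by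
      simpa [(Fin.castSucc_ne_last i).symm] using hS.1
    cases j using Fin.lastCases with
    | last => exact absurd hS₁ hj
    | cast j =>
      have hins (k : Fin n) : (Finset.univ.filter fun l => Fin.castSucc l ∈ insert k.castSucc S) =
          insert k (Finset.univ.filter fun l => Fin.castSucc l ∈ S) := by
        ext l; simp
      rw [hins] at hS ⊢
      exact ⟨Finset.mem_insert_of_mem hS₁, h i j (Fin.castSucc_le_castSucc_iff.1 hij.le) _
        (by simpa using hj) (by simpa using hi) hS.2⟩

theorem isProper_addVeto (v : SimpleGame n) : v.addVeto.IsProper := fun _ hA =>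
  Finset.mem_compl.1 (mem_addVeto.1 hA.2).1 (mem_addVeto.1 hA.1).1

theorem isWeighted_of_addVeto {v : SimpleGame n} (h : v.addVeto.IsWeighted) : v.IsWeighted := by
  obtain ⟨w, q, hw, -, -, h⟩ := h
  refine isWeighted_of_mem_iff (fun i => w i.castSucc) (q - w (Fin.last n)) (fun i => hw _)
    fun A => ?_
  have hA : insert (Fin.last n) (A.map Fin.castSuccEmb) ∈ v.addVeto.winning ↔ A ∈ v.winning := by
    simp [mem_addVeto, Fin.castSucc_ne_last]
  rw [← hA, h, Finset.sum_insert (by simp [Fin.castSucc_ne_last]), Finset.sum_map,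
    sub_le_iff_le_add']
  rfl

/-- The game with six voters in which a coalition wins if it has at least four members or contains
the two strongest voters. -/
def fourOrTopTwo : SimpleGame 6 where
  winning := Finset.univ.filter fun A => 4 ≤ A.card ∨ 4 ∈ A ∧ 5 ∈ A
  univ_mem := by simp
  empty_notMem := by simp
  mono S R hS h := by
    simp only [Finset.mem_filter_univ] at hS ⊢
    exact hS.imp (fun hS => hS.trans (Finset.card_le_card h)) fun hS => ⟨h hS.1, h hS.2⟩

theorem isOrdered_fourOrTopTwo : fourOrTopTwo.IsOrdered := by
  unfold IsOrdered MoreDesirable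
  decide +kernel

theorem inTopHalf_fourOrTopTwo : fourOrTopTwo.InTopHalf := by
  unfold InTopHalf rank
  decide +kernel

theorem not_isProper_fourOrTopTwo : ¬ fourOrTopTwo.IsProper := fun h =>
  h {4, 5} (by decide +kernel)

theorem not_isWeighted_fourOrTopTwo : ¬ fourOrTopTwo.IsWeighted := fun h =>
  not_isProper_fourOrTopTwo (h.isProper_of_inTopHalf inTopHalf_fourOrTopTwo)

theorem exists_inTopHalf_not_isProper (hn : 6 ≤ n) :
    ∃ v : SimpleGame n, v.IsOrdered ∧ v.InTopHalf ∧ ¬ v.IsProper := by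
  induction n, hn using Nat.le_induction with
  | base =>
    exact ⟨_, isOrdered_fourOrTopTwo, inTopHalf_fourOrTopTwo, not_isProper_fourOrTopTwo⟩
  | succ n _ ih =>
    obtain ⟨v, h₁, h₂, h₃⟩ := ih
    exact ⟨v.addNull, h₁.addNull, h₂.addNull, mt isProper_addNull.1 h₃⟩

theorem exists_isProper_not_isWeighted (hn : 7 ≤ n) :
    ∃ v : SimpleGame n, v.IsOrdered ∧ v.IsProper ∧ ¬ v.IsWeighted := by
  induction n, hn using Nat.le_induction with
  | base =>
    exact ⟨_, isOrdered_fourOrTopTwo.addVeto, isProper_addVeto _,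
      mt isWeighted_of_addVeto not_isWeighted_fourOrTopTwo⟩
  | succ n _ ih =>
    obtain ⟨v, h₁, h₂, h₃⟩ := ih
    exact ⟨v.addNull, h₁.addNull, isProper_addNull.2 h₂, mt isWeighted_of_addNull h₃⟩

/-- The predicate on codes of coalitions that a proper linear game defines is compatible with
`admissible`. -/
theorem admissible_of_mem {v : SimpleGame 6} (ho : v.IsOrdered) (hp : v.IsProper) {c m : ℕ}
    (hc : c < 64 ∧ coalition c ∈ v.winning)
    (hm : ∀ d, m.testBit d = true ↔ c + 1 ≤ d ∧ d < 64 ∧ coalition d ∈ v.winning) :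
    admissible c m = true := by
  have hsub : c.testBit 0 = false → m.testBit (c + 1) = true := fun h => by
    obtain ⟨hlt, hs⟩ := coalition_subset_succ c hc.1 h
    exact (hm _).2 ⟨le_rfl, hlt, v.mono _ _ hc.2 hs⟩
  have hshift (i : Fin 5) : c.testBit i = true → c.testBit (i + 1) = false →
      m.testBit (c + 2 ^ (i : ℕ)) = true := fun h h' => by
    obtain ⟨hlt, he, hni, he'⟩ := coalition_shift c hc.1 i h h'
    refine (hm _).2 ⟨Nat.add_le_add_left Nat.one_le_two_pow c, hlt, ?_⟩
    rw [he']
    exact ho i.castSucc i.succ i.castSucc_lt_succ.le _ hni (Finset.notMem_erase _ _) (he ▸ hc.2)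
  have hcompl : m.testBit (63 - c) = false := by
    rw [← Bool.not_eq_true]
    intro h
    exact hp (coalition c) ⟨hc.2, coalition_compl c hc.1 ▸ ((hm _).1 h).2.2⟩
  have h0 := hshift 0
  have h1 := hshift 1
  have h2 := hshift 2
  have h3 := hshift 3
  have h4 := hshift 4
  simp only [admissible, Bool.and_eq_true, Bool.or_eq_true, Bool.not_eq_true', hcompl, and_true]
  norm_num at h0 h1 h2 h3 h4 hsub
  grind

theorem isWeighted_of_isProper_six {v : SimpleGame 6} (ho : v.IsOrdered) (hp : v.IsProper) :
    v.IsWeighted := by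
  have huniv : coalition 63 = Finset.univ := by decide
  obtain ⟨m, hm, hmv⟩ := exists_mem_extensions (p := fun c => c < 64 ∧ coalition c ∈ v.winning)
    (fun c m hc hm => admissible_of_mem ho hp hc hm) 63 (2 ^ 63) fun d => by
      rw [Nat.testBit_two_pow, decide_eq_true_eq]
      constructor
      · rintro rfl
        exact ⟨le_rfl, by norm_num, huniv ▸ v.univ_mem⟩
      · intro h
        omega
  obtain ⟨t, ht⟩ := exists_of_realizesAll realizesAll_quotaWeights hm
  refine isWeighted_of_mem_iff (fun i => ((t / 10 ^ (5 - (i : ℕ)) % 10 : ℕ) : ℝ))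
    ((t / 1000000 : ℕ) : ℝ) (fun i => Nat.cast_nonneg _) fun A => ?_
  obtain ⟨c, hc, rfl⟩ := coalition_surjective A
  rw [← Nat.cast_sum, Nat.cast_le, sum_coalition, ← testBit_iff_of_agrees (m := m) (c := c), hmv]
  · simp [hc]
  · rwa [Nat.div_eq_of_lt (a := c) (by simpa using hc)]

theorem isWeighted_of_isProper (hn : n ≤ 6) {v : SimpleGame n} (ho : v.IsOrdered)
    (hp : v.IsProper) : v.IsWeighted := by
  induction hn using Nat.decreasingInduction with
  | self => exact isWeighted_of_isProper_six ho hp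
  | of_succ k _ ih => exact isWeighted_of_addNull (ih ho.addNull (isProper_addNull.2 hp))

theorem isWeighted_of_isOrdered (hn : n ≤ 5) {v : SimpleGame n} (ho : v.IsOrdered) :
    v.IsWeighted :=
  isWeighted_of_addVeto
    (isWeighted_of_isProper (Nat.succ_le_succ hn) ho.addVeto (isProper_addVeto v))

theorem IsProper.of_subset {u v : SimpleGame n} (hu : u.IsProper) (h : v.winning ⊆ u.winning) :
    v.IsProper := fun A hA => hu A ⟨h hA.1, h hA.2⟩

/-- Between two ordered games, a losing coalition of the smaller one can be removed from the larger
one so that the result is again an ordered game. -/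
theorem exists_coversGame {u v : SimpleGame n} (hu : u.IsOrdered) (hv : v.IsOrdered)
    (h : v.winning ⊂ u.winning) :
    ∃ u' : SimpleGame n, u'.IsOrdered ∧ v.winning ⊆ u'.winning ∧ u'.CoversGame u := by
  let f : Finset (Fin n) → ℕ := fun A => ∑ i ∈ A, ((i : ℕ) + 1)
  obtain ⟨A, hA, hmin⟩ := Finset.exists_min_image (u.winning \ v.winning) f
    (Finset.sdiff_nonempty.2 h.2)
  rw [Finset.mem_sdiff] at hA
  have hlt {S : Finset (Fin n)} (hS : S ∈ u.winning) (hf : f S < f A) : S ∈ v.winning := by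
    by_contra hS'
    exact absurd (hmin S (Finset.mem_sdiff.2 ⟨hS, hS'⟩)) (not_le.2 hf)
  refine ⟨⟨u.winning.erase A, ?_, ?_, ?_⟩, ?_, ?_, A, ?_, ?_⟩
  · exact Finset.mem_erase.2 ⟨fun h => hA.2 (h ▸ v.univ_mem), u.univ_mem⟩
  · exact fun h => u.empty_notMem (Finset.mem_of_mem_erase h)
  · intro S R hS hSR
    rw [Finset.mem_erase] at hS ⊢
    refine ⟨?_, u.mono S R hS.2 hSR⟩
    rintro rfl
    have hf : f S < f R := by
      obtain ⟨i, hi, hi'⟩ := Finset.exists_of_ssubset (hSR.ssubset_of_ne hS.1)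
      exact Finset.sum_lt_sum_of_subset hSR hi hi' (Nat.succ_pos _) fun _ _ _ => Nat.zero_le _
    exact hA.2 (v.mono S R (hlt hS.2 hf) hSR)
  · intro i j hij S hj hi hS
    simp only [Finset.mem_erase] at hS ⊢
    refine ⟨?_, hu i j hij S hj hi hS.2⟩
    rintro rfl
    have hne : i ≠ j := fun h => hS.1 (by rw [h])
    have hf : f (insert i S) < f (insert j S) := by
      have : (i : ℕ) < j := lt_of_le_of_ne hij (Fin.val_ne_of_ne hne)
      simp only [f, Finset.sum_insert hi, Finset.sum_insert hj]
      omega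
    exact hA.2 (hv i j hij S hj hi (hlt hS.2 hf))
  · exact fun S hS => Finset.mem_erase.2 ⟨fun h => hA.2 (h ▸ hS), h.1 hS⟩
  · exact Finset.notMem_erase _ _
  · exact (Finset.insert_erase hA.1).symm

theorem reflTransGen_weightedStep (hn : n ≤ 6) {u v : SimpleGame n} (hu : u.IsOrdered)
    (hp : u.IsProper) (hv : v.IsOrdered) (h : v.winning ⊆ u.winning) :
    Relation.ReflTransGen WeightedStep u v := by
  induction hk : u.winning.card using Nat.strong_induction_on generalizing u with
  | _ k ih =>
    rcases h.eq_or_ssubset with h | h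
    · rw [SimpleGame.ext h]
    · obtain ⟨u', hu', hvu', A, hA, hAu⟩ := exists_coversGame hu hv h
      have hp' : u'.IsProper := hp.of_subset (hAu ▸ Finset.subset_insert _ _)
      have hstep : WeightedStep u u' :=
        ⟨⟨mem_linearPoset.2 hu, isWeighted_of_isProper hn hu hp⟩,
          ⟨mem_linearPoset.2 hu', isWeighted_of_isProper hn hu' hp'⟩, A, hA, hAu⟩
      refine .head hstep (ih u'.winning.card ?_ hu' hp' hvu' rfl)
      rw [← hk, hAu, Finset.card_insert_of_notMem hA]
      exact Nat.lt_succ_self _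

end SimpleGame

namespace GamePoset

variable {n : ℕ}

theorem IsSubposet.antisymm {P Q : GamePoset n} (h : P.IsSubposet Q) (h' : Q.IsSubposet P) :
    P = Q :=
  GamePoset.ext (h.1.antisymm h'.1)
    (funext fun u => funext fun v => propext ⟨h.2 u v, h'.2 u v⟩)

theorem induced_congr {P : GamePoset n} {p q : SimpleGame n → Prop}
    (h : ∀ v ∈ P.carrier, p v ↔ q v) : P.induced p = P.induced q := by
  have key {p q : SimpleGame n → Prop} (h : ∀ v ∈ P.carrier, p v → q v) :
      (P.induced p).IsSubposet (P.induced q) :=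
    ⟨fun v hv => ⟨hv.1, h v hv.1 hv.2⟩, fun u v huv => ⟨huv.1,
      h u (P.mem_of_le u v huv.1).1 huv.2.1, h v (P.mem_of_le u v huv.1).2 huv.2.2⟩⟩
  exact (key fun v hv => (h v hv).1).antisymm (key fun v hv => (h v hv).2)

end GamePoset

open SimpleGame GamePoset

theorem weightedPoset_isSubposet (n : ℕ) : (weightedPoset n).IsSubposet (linearPoset n) :=
  ⟨fun _ hv => hv.1, fun _ _ h => ⟨h.1.1, h.2.1.1, winning_subset_of_chain h.2.2⟩⟩

theorem properWeightedPoset_isSubposet (n : ℕ) :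
    (properWeightedPoset n).IsSubposet (properLinearPoset n) :=
  ⟨fun _ hv => ⟨(weightedPoset_isSubposet n).1 hv.1, hv.2⟩,
    fun u v h => ⟨(weightedPoset_isSubposet n).2 u v h.1, h.2⟩⟩

theorem properLinearPoset_isSubposet (n : ℕ) :
    (properLinearPoset n).IsSubposet (topLinearPoset n) :=
  ⟨fun _ hv => ⟨hv.1, hv.2.inTopHalf⟩, fun _ _ h => ⟨h.1, h.2.1.inTopHalf, h.2.2.inTopHalf⟩⟩

theorem properWeightedPoset_eq_topWeightedPoset (n : ℕ) :
    properWeightedPoset n = topWeightedPoset n :=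
  induced_congr fun _ hv => isProper_iff_inTopHalf hv.2

theorem properWeightedPoset_eq_properLinearPoset {n : ℕ} (hn : n ≤ 6) :
    properWeightedPoset n = properLinearPoset n := by
  have hw {v : SimpleGame n} (hv : v ∈ (linearPoset n).carrier) (hp : v.IsProper) :
      v ∈ (weightedPoset n).carrier :=
    ⟨hv, isWeighted_of_isProper hn (mem_linearPoset.1 hv) hp⟩
  refine (properWeightedPoset_isSubposet n).antisymm ⟨fun v hv => ⟨hw hv.1 hv.2, hv.2⟩, ?_⟩
  rintro u v ⟨⟨hu, hv, h⟩, hpu, hpv⟩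
  exact ⟨⟨hw hu hpu, hw hv hpv, reflTransGen_weightedStep hn hu.2 hpu hv.2 h⟩, hpu, hpv⟩

theorem properLinearPoset_eq_topLinearPoset {n : ℕ} (hn : n ≤ 5) :
    properLinearPoset n = topLinearPoset n :=
  induced_congr fun _ hv => isProper_iff_inTopHalf (isWeighted_of_isOrdered hn hv.2)

theorem theorem3p2 (n : ℕ) :
    (properWeightedPoset n).IsSubposet (properLinearPoset n) ∧
    (properLinearPoset n).IsSubposet (topLinearPoset n) ∧
    properWeightedPoset n = topWeightedPoset n ∧
    ((properWeightedPoset n).carrier ⊂ (properLinearPoset n).carrier ↔ 7 ≤ n) ∧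
    ((properLinearPoset n).carrier ⊂ (topLinearPoset n).carrier ↔ 6 ≤ n) ∧
    (n ≤ 6 → properWeightedPoset n = properLinearPoset n) ∧
    (n ≤ 5 → properLinearPoset n = topLinearPoset n) := by
  refine ⟨properWeightedPoset_isSubposet n, properLinearPoset_isSubposet n,
    properWeightedPoset_eq_topWeightedPoset n, ⟨fun h => ?_, fun hn => ?_⟩,
    ⟨fun h => ?_, fun hn => ?_⟩, properWeightedPoset_eq_properLinearPoset,
    properLinearPoset_eq_topLinearPoset⟩
  · by_contra hn
    rw [properWeightedPoset_eq_properLinearPoset (by omega)] at h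
    exact h.ne rfl
  · obtain ⟨v, ho, hp, hw⟩ := exists_isProper_not_isWeighted hn
    exact ⟨(properWeightedPoset_isSubposet n).1,
      fun h => hw (h (show v ∈ _ from ⟨mem_linearPoset.2 ho, hp⟩)).1.2⟩
  · by_contra hn
    rw [properLinearPoset_eq_topLinearPoset (by omega)] at h
    exact h.ne rfl
  · obtain ⟨v, ho, ht, hp⟩ := exists_inTopHalf_not_isProper hn
    exact ⟨(properLinearPoset_isSubposet n).1,
      fun h => hp (h (show v ∈ _ from ⟨mem_linearPoset.2 ho, ht⟩)).2⟩
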